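/- Let $\mathbb{K}$ be a field of characteristic zero and $\mathcal{D}$ a nonempty set; for a set $X$, $\mathbb{K}(X)$ denotes the vector space with basis $X$. A rooted forest is a finite (possibly empty) disjoint union of rooted trees, its edges being oriented towards the roots; write $v \twoheadrightarrow w$ if there is an oriented path (possibly of length $0$) from the vertex $v$ to the vertex $w$. Let $\mathbf{H}_{CK}^{\mathcal{D}}$ be the Connes–Kreimer Hopf algebra: it has as a basis the set of (isomorphism classes of) rooted forests with vertices decorated by elements of $\mathcal{D}$; its product is the disjoint union of forests, its unit is the empty forest $1$, its coproduct is $$\Delta(F)=\sum_{\boldsymbol{v}} Lea_{\boldsymbol{v}}(F)\otimes Roo_{\boldsymbol{v}}(F),$$ and its counit sends $1$ to $1$ and every nonempty forest to $0$. Here $\boldsymbol{v}$ runs over the admissible cuts of $F$, i.e. the sets of vertices of $F$ such that $v\twoheadrightarrow w$ for no two different $v,w\in\boldsymbol{v}$; $Lea_{\boldsymbol{v}}(F)$ is the subforest formed by the vertices $w$ with $w\twoheadrightarrow v$ for some $v\in\boldsymbol{v}$ and the edges between them, and $Roo_{\boldsymbol{v}}(F)$ is formed by the other vertices and the edges between them.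 Let $\mathbb{T}^{\mathcal{D}}$ be the set of nonempty rooted trees decorated by $\mathcal{D}$ and $i:\mathbb{K}(\mathbb{T}^{\mathcal{D}})\hookrightarrow \mathbf{H}_{CK}^{\mathcal{D}}$ the inclusion. Let $\mathbf{Sh}^{\mathcal{D}}$ be the shuffle Hopf algebra: it has as a basis the set of finite words in the alphabet $\mathcal{D}$; its product is the shuffle product, its unit is the empty word, its coproduct is the deconcatenation $\Delta(v_1\cdots v_n)=\sum_{k=0}^n (v_1\cdots v_k)\otimes(v_{k+1}\cdots v_n)$, and its counit sends the empty word to $1$ and every nonempty word to $0$. Let $\pi:\mathbf{Sh}^{\mathcal{D}}\to\mathbb{K}(\mathcal{D})$ be the linear map sending a word with exactly one letter to this letter and every other word to $0$. Then for every linear map $\varphi:\mathbb{K}(\mathbb{T}^{\mathcal{D}})\to\mathbb{K}(\mathcal{D})$ there is a unique Hopf algebra morphism $\Phi:\mathbf{H}_{CK}^{\mathcal{D}}\to\mathbf{Sh}^{\mathcal{D}}$ such that $\pi\circ\Phi\circ i=\varphi$. -/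

import Mathlib

open scoped TensorProduct

namespace CutShuffle

universe u w

/-! ## Decorated rooted forests -/

/-- A finite rooted forest with vertices decorated by `D`, edges oriented from the leaves to the
roots: `Edge v w` means `v → w` (`w` is the parent of `v`). Every vertex has at most one outgoing
edge and there are no oriented cycles, so every connected component is a tree oriented towards its
unique vertex without outgoing edge, its root. The empty forest is allowed. -/
structure DecForest (D : Type u) where
  V : Type
  finite : Finite V
  Edge : V → V → Prop
  edge_unique : ∀ {v w w'}, Edge v w → Edge v w' → w = w'
  acyclic : ∀ v, ¬ Relation.TransGen Edge v v
  deco : V → D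

namespace DecForest

variable {D : Type u}

instance (F : DecForest D) : Finite F.V := F.finite

/-- `v ↠ w`: there is an oriented path (possibly of length zero) from `v` to `w`. -/
def Reach (F : DecForest D) : F.V → F.V → Prop := Relation.ReflTransGen F.Edge

/-- An isomorphism of decorated rooted forests. -/
structure Iso (F G : DecForest D) where
  toEquiv : F.V ≃ G.V
  edge_iff : ∀ v w, G.Edge (toEquiv v) (toEquiv w) ↔ F.Edge v w
  deco_eq : ∀ v, G.deco (toEquiv v) = F.deco v

def Iso.refl (F : DecForest D) : Iso F F := ⟨Equiv.refl _, fun _ _ => Iff.rfl, fun _ => rfl⟩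

def Iso.symm {F G : DecForest D} (e : Iso F G) : Iso G F where
  toEquiv := e.toEquiv.symm
  edge_iff v w := by rw [← e.edge_iff]; simp
  deco_eq v := by rw [← e.deco_eq]; simp

def Iso.trans {F G H : DecForest D} (e : Iso F G) (f : Iso G H) : Iso F H where
  toEquiv := e.toEquiv.trans f.toEquiv
  edge_iff v w := by simp [f.edge_iff, e.edge_iff]
  deco_eq v := by simp [f.deco_eq, e.deco_eq]

instance setoid (D : Type u) : Setoid (DecForest D) where
  r F G := Nonempty (Iso F G)
  iseqv := ⟨fun F => ⟨Iso.refl F⟩, fun ⟨e⟩ => ⟨e.symm⟩, fun ⟨e⟩ ⟨f⟩ => ⟨e.trans f⟩⟩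

/-- The empty forest. -/
def empty (D : Type u) : DecForest D where
  V := Empty
  finite := inferInstance
  Edge _ _ := False
  edge_unique h := h.elim
  acyclic v := v.elim
  deco v := v.elim

/-- The forest obtained from `F` by keeping only the vertices in `S` and the edges between them. -/
def restrict (F : DecForest D) (S : Set F.V) : DecForest D where
  V := S
  finite := inferInstance
  Edge v w := F.Edge v w
  edge_unique h h' := Subtype.ext (F.edge_unique h h')
  acyclic v h := F.acyclic v
    (Relation.TransGen.lift (p := F.Edge) (Subtype.val : S → F.V) (fun _ _ h => h) _ _ h)
  deco v := F.deco v

/-- The disjoint union of two forests. -/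
def disjUnion (F G : DecForest D) : DecForest D where
  V := F.V ⊕ G.V
  finite := inferInstance
  Edge
    | .inl v, .inl w => F.Edge v w
    | .inr v, .inr w => G.Edge v w
    | _, _ => False
  edge_unique := by
    rintro (v | v) (w | w) (w' | w') h h'
    exacts [congrArg _ (F.edge_unique h h'), h'.elim, h.elim, h.elim, h.elim, h.elim, h'.elim,
      congrArg _ (G.edge_unique h h')]
  acyclic := by
    have key : ∀ a b : F.V ⊕ G.V, Relation.TransGen (fun a b : F.V ⊕ G.V => match a, b with
        | .inl v, .inl w => F.Edge v w
        | .inr v, .inr w => G.Edge v w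
        | _, _ => False) a b →
        Sum.LiftRel (Relation.TransGen F.Edge) (Relation.TransGen G.Edge) a b := by
      intro a b h
      induction h with
      | @single c h =>
        rcases a with a | a <;> rcases c with c | c
        exacts [.inl (.single h), h.elim, h.elim, .inr (.single h)]
      | @tail c d _ h ih =>
        rcases c with c | c <;> rcases d with d | d
        · rcases ih with ⟨ih⟩
          exact .inl (.tail ih h)
        · exact h.elim
        · exact h.elim
        · rcases ih with _ | ⟨ih⟩
          exact .inr (.tail ih h)
    intro v h
    rcases key v v h with ⟨h⟩ | ⟨h⟩
    · exact F.acyclic _ h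
    · exact G.acyclic _ h
  deco := Sum.elim F.deco G.deco

/-- A set of vertices is an admissible cut if there is no oriented path between two different
vertices of it. -/
def IsAdmissible (F : DecForest D) (v : Set F.V) : Prop :=
  ∀ a ∈ v, ∀ b ∈ v, a ≠ b → ¬ F.Reach a b

/-- The set of vertices above a set `v` of vertices. -/
def above (F : DecForest D) (v : Set F.V) : Set F.V := {w | ∃ a ∈ v, F.Reach w a}

/-- `Lea_v(F)`: the vertices above the cut `v`. -/
def lea (F : DecForest D) (v : Set F.V) : DecForest D := F.restrict (F.above v)

/-- `Roo_v(F)`: the other vertices. -/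
def roo (F : DecForest D) (v : Set F.V) : DecForest D := F.restrict (F.above v)ᶜ

/-- A forest is a (nonempty) rooted tree if it has a vertex to which every vertex is connected
by an oriented path. -/
def IsTree (F : DecForest D) : Prop := ∃ r, ∀ v, F.Reach v r

/-! Isomorphism invariance. -/

theorem Iso.reach {F G : DecForest D} (e : Iso F G) {v w : F.V} (h : F.Reach v w) :
    G.Reach (e.toEquiv v) (e.toEquiv w) :=
  Relation.ReflTransGen.lift e.toEquiv (fun _ _ h => (e.edge_iff _ _).2 h) _ _ h

theorem Iso.reach_iff {F G : DecForest D} (e : Iso F G) (v w : F.V) :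
    G.Reach (e.toEquiv v) (e.toEquiv w) ↔ F.Reach v w :=
  ⟨fun h => by simpa [Iso.symm] using e.symm.reach h, e.reach⟩

theorem Iso.isTree {F G : DecForest D} (e : Iso F G) (h : F.IsTree) : G.IsTree := by
  obtain ⟨r, hr⟩ := h
  refine ⟨e.toEquiv r, fun v => ?_⟩
  have := e.reach (hr (e.toEquiv.symm v))
  simpa using this

/-- Isomorphic forests restrict to isomorphic forests on corresponding sets of vertices. -/
def Iso.restrict {F G : DecForest D} (e : Iso F G) (S : Set F.V) (T : Set G.V)
    (h : ∀ v, e.toEquiv v ∈ T ↔ v ∈ S) : Iso (F.restrict S) (G.restrict T) where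
  toEquiv := e.toEquiv.subtypeEquiv fun v => (h v).symm
  edge_iff v w := e.edge_iff v.1 w.1
  deco_eq v := e.deco_eq v.1

def Iso.disjUnion {F F' G G' : DecForest D} (e : Iso F F') (f : Iso G G') :
    Iso (F.disjUnion G) (F'.disjUnion G') where
  toEquiv := Equiv.sumCongr e.toEquiv f.toEquiv
  edge_iff v w := by
    rcases v with v | v <;> rcases w with w | w
    exacts [e.edge_iff v w, Iff.rfl, Iff.rfl, f.edge_iff v w]
  deco_eq v := by
    rcases v with v | v
    exacts [e.deco_eq v, f.deco_eq v]

/-- Sets of vertices containing every vertex above one of their elements. -/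
def IsClosedAbove (F : DecForest D) (S : Set F.V) : Prop := ∀ v w, F.Edge v w → w ∈ S → v ∈ S

theorem IsClosedAbove.reach {F : DecForest D} {S : Set F.V} (hS : F.IsClosedAbove S) {v w : F.V}
    (h : F.Reach v w) (hw : w ∈ S) : v ∈ S := by
  induction h using Relation.ReflTransGen.head_induction_on with
  | refl => exact hw
  | head h _ ih => exact hS _ _ h ih

theorem reach_antisymm {F : DecForest D} {v w : F.V} (h : F.Reach v w) (h' : F.Reach w v) :
    v = w := by
  rcases Relation.reflTransGen_iff_eq_or_transGen.1 h with h | h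
  · exact h.symm
  · exact (F.acyclic _ (h.trans_left h')).elim

theorem exists_minimal {F : DecForest D} {S : Set F.V} {v : F.V} (hv : v ∈ S) :
    ∃ m ∈ S, F.Reach v m ∧ ∀ x ∈ S, F.Reach m x → x = m := by
  let _ : PartialOrder F.V :=
    { le := fun a b => F.Reach b a
      le_refl := fun a => Relation.ReflTransGen.refl
      le_trans := fun a b c h h' => Relation.ReflTransGen.trans h' h
      le_antisymm := fun a b h h' => reach_antisymm h' h }
  obtain ⟨m, hm, hmin⟩ := (Set.toFinite S).exists_le_minimal hv
  exact ⟨m, hmin.1, hm, fun x hx h => (hmin.eq_of_le hx h)⟩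

/-- Admissible cuts correspond to sets of vertices that are closed above. -/
def admissibleEquiv (F : DecForest D) :
    {v : Set F.V // F.IsAdmissible v} ≃ {S : Set F.V // F.IsClosedAbove S} where
  toFun v := ⟨F.above v, fun a b h ⟨c, hc, hb⟩ => ⟨c, hc, Relation.ReflTransGen.head h hb⟩⟩
  invFun S := ⟨{m | m ∈ S.1 ∧ ∀ x ∈ S.1, F.Reach m x → x = m},
    fun a ha b hb hab h => hab (ha.2 b hb.1 h).symm⟩
  left_inv v := by
    apply Subtype.ext
    ext m
    constructor
    · rintro ⟨⟨a, ha, hm⟩, h⟩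
      exact h a ⟨a, ha, Relation.ReflTransGen.refl⟩ hm ▸ ha
    · intro hm
      refine ⟨⟨m, hm, Relation.ReflTransGen.refl⟩, ?_⟩
      rintro x ⟨a, ha, hx⟩ hmx
      have : m = a := by
        by_contra hne
        exact v.2 m hm a ha hne (hmx.trans hx)
      subst this
      exact reach_antisymm hx hmx
  right_inv S := by
    apply Subtype.ext
    ext x
    constructor
    · rintro ⟨a, ha, hx⟩
      exact S.2.reach hx ha.1
    · intro hx
      obtain ⟨m, hm, hxm, h⟩ := exists_minimal hx
      exact ⟨m, ⟨hm, h⟩, hxm⟩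

noncomputable instance (F : DecForest D) : Fintype {v : Set F.V // F.IsAdmissible v} :=
  Fintype.ofFinite _

noncomputable instance (F : DecForest D) : Fintype {v : Set F.V // F.IsClosedAbove v} :=
  Fintype.ofFinite _

end DecForest

/-- The set of decorated rooted forests, up to isomorphism. -/
def Forest (D : Type u) : Type (max 1 u) := Quotient (DecForest.setoid D)

namespace Forest

variable {D : Type u}

/-- The isomorphism class of a forest. -/
def mk (F : DecForest D) : Forest D := Quotient.mk _ F

theorem mk_eq {F G : DecForest D} (e : F.Iso G) : mk F = mk G := Quotient.sound ⟨e⟩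

theorem ind {p : Forest D → Prop} (h : ∀ F, p (mk F)) (F : Forest D) : p F := Quotient.ind h F

/-- The product of forests is the disjoint union; the unit is the empty forest. -/
instance : CommMonoid (Forest D) where
  one := mk (DecForest.empty D)
  mul := Quotient.map₂ DecForest.disjUnion fun _ _ ⟨e⟩ _ _ ⟨f⟩ => ⟨e.disjUnion f⟩
  mul_assoc F G H := by
    induction F using ind
    induction G using ind
    induction H using ind
    refine mk_eq ⟨Equiv.sumAssoc _ _ _, ?_, ?_⟩
    · rintro ((_ | _) | _) ((_ | _) | _) <;> rfl
    · rintro ((_ | _) | _) <;> rfl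
  one_mul F := by
    induction F using ind
    refine mk_eq ⟨Equiv.emptySum Empty _, ?_, ?_⟩
    · rintro (⟨⟨⟩⟩ | _) (⟨⟨⟩⟩ | _); rfl
    · rintro (⟨⟨⟩⟩ | _); rfl
  mul_one F := by
    induction F using ind
    refine mk_eq ⟨Equiv.sumEmpty _ Empty, ?_, ?_⟩
    · rintro (_ | ⟨⟨⟩⟩) (_ | ⟨⟨⟩⟩); rfl
    · rintro (_ | ⟨⟨⟩⟩); rfl
  mul_comm F G := by
    induction F using ind
    induction G using ind
    refine mk_eq ⟨Equiv.sumComm _ _, ?_, ?_⟩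
    · rintro (_ | _) (_ | _) <;> rfl
    · rintro (_ | _) <;> rfl

theorem mk_mul (F G : DecForest D) : mk F * mk G = mk (F.disjUnion G) := rfl

theorem one_def : (1 : Forest D) = mk (DecForest.empty D) := rfl

/-- The vertices degree. -/
noncomputable def degree : Forest D → ℕ :=
  Quotient.lift (fun F => Nat.card F.V) fun _ _ ⟨e⟩ => Nat.card_congr e.toEquiv

theorem degree_mk (F : DecForest D) : degree (mk F) = Nat.card F.V := rfl

theorem mk_eq_one {F : DecForest D} [IsEmpty F.V] : mk F = 1 :=
  mk_eq ⟨Equiv.equivOfIsEmpty F.V Empty, fun v => isEmptyElim v, fun v => isEmptyElim v⟩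

theorem degree_eq_zero_iff {F : Forest D} : degree F = 0 ↔ F = 1 := by
  constructor
  · induction F using ind with
    | h F =>
      intro h
      rw [degree_mk, Nat.card_eq_zero, or_iff_left (not_infinite_iff_finite.2 F.finite)] at h
      exact mk_eq_one
  · rintro rfl
    exact Nat.card_eq_zero.2 (.inl (inferInstanceAs (IsEmpty Empty)))

theorem degree_mul (F G : Forest D) : degree (F * G) = degree F + degree G := by
  induction F using ind
  induction G using ind
  exact Nat.card_sum

/-- A forest is a tree if it is connected and nonempty. -/
def IsTree : Forest D → Prop :=
  Quotient.lift DecForest.IsTree fun _ _ ⟨e⟩ => propext ⟨e.isTree, e.symm.isTree⟩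

theorem mk_restrict_restrict (F : DecForest D) (S : Set F.V) (T : Set (F.restrict S).V) :
    mk ((F.restrict S).restrict T) = mk (F.restrict (Subtype.val '' T)) := by
  refine mk_eq ⟨Equiv.Set.image _ T Subtype.val_injective, ?_, ?_⟩
  · rintro v w; exact Iff.rfl
  · rintro v; rfl

end Forest

/-- The set of nonempty decorated rooted trees. -/
abbrev Tree (D : Type u) : Type (max 1 u) := {T : Forest D // T.IsTree}

/-! ## The Connes-Kreimer Hopf algebra -/

/-- The vector space spanned by the decorated rooted forests, with the product extending
bilinearly the product of forests. -/
def HCK (K : Type w) (D : Type u) [Field K] : Type (max 1 u w) := MonoidAlgebra K (Forest D)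

namespace HCK

variable (K : Type w) {D : Type u} [Field K]

noncomputable instance : CommRing (HCK K D) := inferInstanceAs (CommRing (MonoidAlgebra K (Forest D)))

noncomputable instance : Algebra K (HCK K D) :=
  inferInstanceAs (Algebra K (MonoidAlgebra K (Forest D)))

/-- The basis of forests. -/
noncomputable def basis : Module.Basis (Forest D) K (HCK K D) :=
  Module.Basis.ofRepr (MonoidAlgebra.coeffLinearEquiv K)

theorem basis_apply (F : Forest D) :
    basis K F = (MonoidAlgebra.single F 1 : MonoidAlgebra K (Forest D)) := rfl

theorem basis_mul (F G : Forest D) : basis K F * basis K G = basis K (F * G) := by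
  simp only [basis_apply]
  exact (MonoidAlgebra.single_mul_single ..).trans (by rw [mul_one])

theorem basis_one : basis K (1 : Forest D) = 1 := rfl

/-- The sum of `Lea_v(F) ⊗ Roo_v(F)` over the admissible cuts `v` of `F`. -/
noncomputable def cutSum (F : DecForest D) : HCK K D ⊗[K] HCK K D :=
  ∑ v : {v : Set F.V // F.IsAdmissible v},
    basis K (Forest.mk (F.lea v)) ⊗ₜ[K] basis K (Forest.mk (F.roo v))

theorem cutSum_eq (F : DecForest D) :
    cutSum K F = ∑ S : {S : Set F.V // F.IsClosedAbove S},
      basis K (Forest.mk (F.restrict S)) ⊗ₜ[K] basis K (Forest.mk (F.restrict S.1ᶜ)) :=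
  Fintype.sum_equiv F.admissibleEquiv _ _ fun _ => rfl

theorem cutSum_congr {F G : DecForest D} (e : F.Iso G) : cutSum K F = cutSum K G := by
  rw [cutSum_eq, cutSum_eq]
  have hmem : ∀ (S : Set F.V) (v : F.V), e.toEquiv v ∈ Equiv.Set.congr e.toEquiv S ↔ v ∈ S := by
    intro S v
    simp
  have hcl : ∀ S : Set F.V, F.IsClosedAbove S ↔
      G.IsClosedAbove (Equiv.Set.congr e.toEquiv S) := by
    intro S
    constructor
    · intro h v w hvw hw
      obtain ⟨v, rfl⟩ := e.toEquiv.surjective v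
      obtain ⟨w, rfl⟩ := e.toEquiv.surjective w
      exact (hmem S v).2 (h v w ((e.edge_iff v w).1 hvw) ((hmem S w).1 hw))
    · intro h v w hvw hw
      exact (hmem S v).1 (h _ _ ((e.edge_iff v w).2 hvw) ((hmem S w).2 hw))
  refine Fintype.sum_equiv ((Equiv.Set.congr e.toEquiv).subtypeEquiv hcl) _ _ fun S => ?_
  rw [Forest.mk_eq (e.restrict S.1 (Equiv.Set.congr e.toEquiv S.1) (hmem S.1)),
    Forest.mk_eq (e.restrict S.1ᶜ (Equiv.Set.congr e.toEquiv S.1)ᶜ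
      fun v => not_congr (hmem S.1 v))]
  rfl

/-- Sets closed above in a disjoint union. -/
def closedSumEquiv (F G : DecForest D) : {S // (F.disjUnion G).IsClosedAbove S} ≃
    {S // F.IsClosedAbove S} × {S // G.IsClosedAbove S} where
  toFun S := (⟨{v | Sum.inl v ∈ S.1}, fun v w => S.2 (Sum.inl v) (Sum.inl w)⟩,
    ⟨{v | Sum.inr v ∈ S.1}, fun v w => S.2 (Sum.inr v) (Sum.inr w)⟩)
  invFun p := ⟨{x : F.V ⊕ G.V | Sum.elim (· ∈ p.1.1) (· ∈ p.2.1) x}, by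
    rintro (v | v) (w | w) h hw
    exacts [p.1.2 v w h hw, h.elim, h.elim, p.2.2 v w h hw]⟩
  left_inv S := by
    apply Subtype.ext
    ext (x | x) <;> exact Iff.rfl
  right_inv p := rfl

/-- Restriction of a disjoint union. -/
def restrictSumIso (F G : DecForest D) (S : Set (F.disjUnion G).V) (A : Set F.V) (B : Set G.V)
    (hA : ∀ v : F.V, Sum.inl v ∈ S ↔ v ∈ A) (hB : ∀ v : G.V, Sum.inr v ∈ S ↔ v ∈ B) :
    ((F.disjUnion G).restrict S).Iso ((F.restrict A).disjUnion (G.restrict B)) where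
  toEquiv :=
    { toFun := fun x => match x with
        | ⟨.inl v, h⟩ => .inl ⟨v, (hA v).1 h⟩
        | ⟨.inr v, h⟩ => .inr ⟨v, (hB v).1 h⟩
      invFun := fun x => match x with
        | .inl v => ⟨.inl v.1, (hA v.1).2 v.2⟩
        | .inr v => ⟨.inr v.1, (hB v.1).2 v.2⟩
      left_inv := by rintro ⟨v | v, h⟩ <;> rfl
      right_inv := by rintro (⟨v, h⟩ | ⟨v, h⟩) <;> rfl }
  edge_iff := by rintro ⟨v | v, h⟩ ⟨w | w, h'⟩ <;> exact Iff.rfl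
  deco_eq := by rintro ⟨v | v, h⟩ <;> rfl

theorem cutSum_mul (F G : DecForest D) :
    cutSum K (F.disjUnion G) = cutSum K F * cutSum K G := by
  rw [cutSum_eq, cutSum_eq, cutSum_eq, Finset.sum_mul_sum, ← Fintype.sum_prod_type']
  refine Fintype.sum_equiv (closedSumEquiv F G) _ _ fun S => ?_
  rw [Algebra.TensorProduct.tmul_mul_tmul, basis_mul, basis_mul, Forest.mk_mul, Forest.mk_mul,
    Forest.mk_eq (restrictSumIso F G S.1 (closedSumEquiv F G S).1.1 (closedSumEquiv F G S).2.1
      (fun _ => Iff.rfl) (fun _ => Iff.rfl)),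
    Forest.mk_eq (restrictSumIso F G S.1ᶜ (closedSumEquiv F G S).1.1ᶜ (closedSumEquiv F G S).2.1ᶜ
      (fun _ => Iff.rfl) (fun _ => Iff.rfl))]

/-- The coproduct on the basis of forests. -/
noncomputable def comulForest : Forest D → HCK K D ⊗[K] HCK K D :=
  Quotient.lift (cutSum K) fun _ _ ⟨e⟩ => cutSum_congr K e

/-- The coproduct of a forest is the sum over its admissible cuts; the counit maps the empty
forest to `1` and the nonempty forests to `0`. -/
noncomputable instance : CoalgebraStruct K (HCK K D) where
  comul := (basis K).constr K (comulForest K)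
  counit := (basis K).constr K fun F => open Classical in if F = 1 then 1 else 0

theorem comul_basis (F : DecForest D) :
    CoalgebraStruct.comul (R := K) (basis K (Forest.mk F)) = cutSum K F :=
  (basis K).constr_basis K _ _

theorem counit_basis_one : CoalgebraStruct.counit (R := K) (basis K (1 : Forest D)) = 1 :=
  ((basis K).constr_basis K _ _).trans (if_pos rfl)

theorem counit_basis {F : Forest D} (h : F ≠ 1) :
    CoalgebraStruct.counit (R := K) (basis K F) = 0 :=
  ((basis K).constr_basis K _ _).trans (if_neg h)

open Classical in
theorem sum_closed_restrict {M : Type*} [AddCommMonoid M] (F : DecForest D)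
    (S : {S // F.IsClosedAbove S}) (f : Set F.V → M) :
    ∑ T : {T // (F.restrict S.1).IsClosedAbove T}, f (Subtype.val '' T.1) =
      ∑ A : {A // F.IsClosedAbove A}, if A.1 ⊆ S.1 then f A.1 else 0 := by
  rw [← Finset.sum_filter]
  refine Finset.sum_bij' (fun T _ => ⟨Subtype.val '' T.1, ?_⟩)
    (fun A _ => ⟨{x : (F.restrict S.1).V | x.1 ∈ A.1}, fun v w h hw => A.2 v.1 w.1 h hw⟩)
    ?_ ?_ ?_ ?_ ?_
  · rintro v _ h ⟨w, hw, rfl⟩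
    exact ⟨⟨v, S.2 _ _ h w.2⟩, T.2 _ _ (by exact h) hw, rfl⟩
  · intro T _
    simp only [Finset.mem_filter, Finset.mem_univ, true_and]
    rintro _ ⟨w, hw, rfl⟩
    exact w.2
  · intros; exact Finset.mem_univ _
  · intro T _
    apply Subtype.ext
    ext x
    constructor
    · rintro ⟨y, hy, h⟩
      exact (Subtype.ext h : y = x) ▸ hy
    · intro h
      exact ⟨x, h, rfl⟩
  · intro A hA
    simp only [Finset.mem_filter, Finset.mem_univ, true_and] at hA
    apply Subtype.ext
    ext x
    constructor
    · rintro ⟨y, hy, rfl⟩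
      exact hy
    · intro h
      exact ⟨⟨x, hA h⟩, h, rfl⟩
  · intros; rfl

open Classical in
theorem sum_closed_restrict_compl {M : Type*} [AddCommMonoid M] (F : DecForest D)
    (A : {A // F.IsClosedAbove A}) (f : Set F.V → M) :
    ∑ T : {T // (F.restrict A.1ᶜ).IsClosedAbove T}, f (A.1 ∪ Subtype.val '' T.1) =
      ∑ S : {S // F.IsClosedAbove S}, if A.1 ⊆ S.1 then f S.1 else 0 := by
  rw [← Finset.sum_filter]
  refine Finset.sum_bij' (fun T _ => ⟨A.1 ∪ Subtype.val '' T.1, ?_⟩)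
    (fun S _ => ⟨{x : (F.restrict A.1ᶜ).V | x.1 ∈ S.1}, fun v w h hw => S.2 v.1 w.1 h hw⟩)
    ?_ ?_ ?_ ?_ ?_
  · rintro v w h (hw | ⟨w, hw, rfl⟩)
    · exact .inl (A.2 _ _ h hw)
    · by_cases hv : v ∈ A.1
      · exact .inl hv
      · exact .inr ⟨⟨v, hv⟩, T.2 _ _ (by exact h) hw, rfl⟩
  · intro T _
    simp only [Finset.mem_filter, Finset.mem_univ, true_and]
    exact Set.subset_union_left
  · intros; exact Finset.mem_univ _
  · intro T _
    apply Subtype.ext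
    ext x
    constructor
    · rintro (h | ⟨y, hy, h⟩)
      · exact (x.2 h).elim
      · exact (Subtype.ext h : y = x) ▸ hy
    · intro h
      exact .inr ⟨x, h, rfl⟩
  · intro S hS
    simp only [Finset.mem_filter, Finset.mem_univ, true_and] at hS
    apply Subtype.ext
    ext x
    constructor
    · rintro (h | ⟨y, hy, rfl⟩)
      · exact hS h
      · exact hy
    · intro h
      by_cases hx : x ∈ A.1
      · exact .inl hx
      · exact .inr ⟨⟨x, hx⟩, h, rfl⟩
  · intros; rfl

open CoalgebraStruct in
theorem coassoc_basis (F : DecForest D) :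
    TensorProduct.assoc K _ _ _ ((comul (R := K)).rTensor _ (cutSum K F)) =
      (comul (R := K)).lTensor _ (cutSum K F) := by
  classical
  have hL : TensorProduct.assoc K _ _ _ ((comul (R := K)).rTensor _ (cutSum K F)) =
      ∑ S : {S // F.IsClosedAbove S}, ∑ A : {A // F.IsClosedAbove A}, if A.1 ⊆ S.1 then
        basis K (Forest.mk (F.restrict A.1)) ⊗ₜ[K] (basis K (Forest.mk (F.restrict (S.1 \ A.1)))
          ⊗ₜ[K] basis K (Forest.mk (F.restrict S.1ᶜ))) else 0 := by
    rw [cutSum_eq, map_sum, map_sum]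
    refine Finset.sum_congr rfl fun S _ => ?_
    rw [LinearMap.rTensor_tmul, comul_basis, cutSum_eq, TensorProduct.sum_tmul, map_sum,
      ← sum_closed_restrict F S (fun A => basis K (Forest.mk (F.restrict A)) ⊗ₜ[K]
        (basis K (Forest.mk (F.restrict (S.1 \ A))) ⊗ₜ[K]
          basis K (Forest.mk (F.restrict S.1ᶜ))))]
    refine Finset.sum_congr rfl fun T _ => ?_
    rw [TensorProduct.assoc_tmul, Forest.mk_restrict_restrict, Forest.mk_restrict_restrict]
    have : Subtype.val '' T.1ᶜ = S.1 \ Subtype.val '' T.1 := by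
      ext x
      constructor
      · rintro ⟨y, hy, rfl⟩
        refine ⟨y.2, ?_⟩
        rintro ⟨z, hz, h⟩
        exact hy ((Subtype.ext h : z = y) ▸ hz)
      · rintro ⟨hx, h⟩
        exact ⟨⟨x, hx⟩, fun h' => h ⟨⟨x, hx⟩, h', rfl⟩, rfl⟩
    exact congrArg (fun X => basis K (Forest.mk (F.restrict (Subtype.val '' T.1))) ⊗ₜ[K]
      (basis K (Forest.mk (F.restrict X)) ⊗ₜ[K] basis K (Forest.mk (F.restrict S.1ᶜ)))) this
  have hR : (comul (R := K)).lTensor _ (cutSum K F) =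
      ∑ A : {A // F.IsClosedAbove A}, ∑ S : {S // F.IsClosedAbove S}, if A.1 ⊆ S.1 then
        basis K (Forest.mk (F.restrict A.1)) ⊗ₜ[K] (basis K (Forest.mk (F.restrict (S.1 \ A.1)))
          ⊗ₜ[K] basis K (Forest.mk (F.restrict S.1ᶜ))) else 0 := by
    rw [cutSum_eq, map_sum]
    refine Finset.sum_congr rfl fun A _ => ?_
    rw [LinearMap.lTensor_tmul, comul_basis, cutSum_eq, TensorProduct.tmul_sum,
      ← sum_closed_restrict_compl F A (fun S => basis K (Forest.mk (F.restrict A.1)) ⊗ₜ[K]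
        (basis K (Forest.mk (F.restrict (S \ A.1))) ⊗ₜ[K]
          basis K (Forest.mk (F.restrict Sᶜ))))]
    refine Finset.sum_congr rfl fun T _ => ?_
    rw [Forest.mk_restrict_restrict, Forest.mk_restrict_restrict]
    have h1 : Subtype.val '' T.1 = (A.1 ∪ Subtype.val '' T.1) \ A.1 := by
      ext x
      constructor
      · rintro ⟨y, hy, rfl⟩
        exact ⟨.inr ⟨y, hy, rfl⟩, y.2⟩
      · rintro ⟨h | h, h'⟩
        exacts [(h' h).elim, h]
    have h2 : Subtype.val '' T.1ᶜ = (A.1 ∪ Subtype.val '' T.1)ᶜ := by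
      ext x
      constructor
      · rintro ⟨y, hy, rfl⟩ (h | ⟨z, hz, h⟩)
        · exact y.2 h
        · exact hy ((Subtype.ext h : z = y) ▸ hz)
      · intro h
        exact ⟨⟨x, fun hx => h (.inl hx)⟩, fun h' => h (.inr ⟨_, h', rfl⟩), rfl⟩
    rw [← h1]
    exact congrArg (fun X => basis K (Forest.mk (F.restrict A.1)) ⊗ₜ[K]
      (basis K (Forest.mk (F.restrict (Subtype.val '' T.1))) ⊗ₜ[K]
        basis K (Forest.mk (F.restrict X)))) h2
  rw [hL, hR, Finset.sum_comm]

theorem mk_restrict_univ (F : DecForest D) : Forest.mk (F.restrict Set.univ) = Forest.mk F :=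
  Forest.mk_eq ⟨Equiv.Set.univ _, fun _ _ => Iff.rfl, fun _ => rfl⟩

theorem mk_restrict_empty (F : DecForest D) : Forest.mk (F.restrict ∅) = 1 :=
  have : IsEmpty (F.restrict ∅).V := inferInstanceAs (IsEmpty (∅ : Set F.V))
  Forest.mk_eq_one

theorem mk_restrict_ne_one {F : DecForest D} {S : Set F.V} (h : S ≠ ∅) :
    Forest.mk (F.restrict S) ≠ 1 := by
  intro h1
  obtain ⟨x, hx⟩ := Set.nonempty_iff_ne_empty.2 h
  obtain ⟨e⟩ := Quotient.exact (h1.trans Forest.one_def)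
  exact (e.toEquiv ⟨x, hx⟩ : Empty).elim

noncomputable instance : Coalgebra K (HCK K D) where
  coassoc := by
    refine (basis K).ext fun F => ?_
    induction F using Forest.ind with
    | h F => simpa [comul_basis] using coassoc_basis K F
  rTensor_counit_comp_comul := by
    refine (basis K).ext fun F => ?_
    induction F using Forest.ind with
    | h F =>
      rw [LinearMap.comp_apply, comul_basis, cutSum_eq, map_sum,
        Fintype.sum_eq_single ⟨∅, fun _ _ _ h => h⟩]
      · simp only [LinearMap.rTensor_tmul, Set.compl_empty, mk_restrict_univ, mk_restrict_empty,
          counit_basis_one, TensorProduct.mk_apply]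
      · intro S hS
        rw [LinearMap.rTensor_tmul, counit_basis K (mk_restrict_ne_one fun h => hS (Subtype.ext h)),
          TensorProduct.zero_tmul]
  lTensor_counit_comp_comul := by
    refine (basis K).ext fun F => ?_
    induction F using Forest.ind with
    | h F =>
      rw [LinearMap.comp_apply, comul_basis, cutSum_eq, map_sum,
        Fintype.sum_eq_single ⟨Set.univ, fun _ _ _ h => h⟩]
      · simp only [LinearMap.lTensor_tmul, Set.compl_univ, mk_restrict_univ, mk_restrict_empty,
          counit_basis_one, TensorProduct.mk_apply, LinearMap.flip_apply]
      · intro S hS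
        rw [LinearMap.lTensor_tmul, counit_basis K (mk_restrict_ne_one fun h => hS (Subtype.ext
          (Set.compl_empty_iff.1 h))), TensorProduct.tmul_zero]

theorem forest_mul_eq_one {F G : Forest D} : F * G = 1 ↔ F = 1 ∧ G = 1 := by
  simp only [← Forest.degree_eq_zero_iff, Forest.degree_mul, Nat.add_eq_zero_iff]

noncomputable instance : Bialgebra K (HCK K D) where
  counit_one := counit_basis_one K
  mul_compr₂_counit := by
    refine LinearMap.ext_basis (basis K) (basis K) fun F G => ?_
    change CoalgebraStruct.counit (R := K) (basis K F * basis K G) =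
      CoalgebraStruct.counit (R := K) (basis K F) * CoalgebraStruct.counit (R := K) (basis K G)
    rw [basis_mul]
    by_cases hF : F = 1
    · subst hF
      rw [one_mul, counit_basis_one, one_mul]
    · rw [counit_basis K hF, counit_basis K fun h => hF (forest_mul_eq_one.1 h).1, zero_mul]
  comul_one := by
    rw [← basis_one, Forest.one_def, comul_basis, cutSum_eq,
      Fintype.sum_eq_single ⟨∅, fun _ _ _ h => h⟩]
    · simp only [Set.compl_empty, mk_restrict_univ, mk_restrict_empty]
      rw [← Forest.one_def, basis_one, Algebra.TensorProduct.one_def]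
    · intro S hS
      exact (hS (Subtype.ext (Set.eq_empty_of_forall_notMem fun x => (x : Empty).elim))).elim
  mul_compr₂_comul := by
    refine LinearMap.ext_basis (basis K) (basis K) fun F G => ?_
    change CoalgebraStruct.comul (R := K) (basis K F * basis K G) =
      CoalgebraStruct.comul (R := K) (basis K F) * CoalgebraStruct.comul (R := K) (basis K G)
    rw [basis_mul]
    induction F using Forest.ind
    induction G using Forest.ind
    rw [Forest.mk_mul, comul_basis, comul_basis, comul_basis, cutSum_mul]

end HCK

/-! ## Antipodes -/

section Antipode

open LinearMap WithConv

variable {K A ι : Type*} [Field K] [CommRing A] [Bialgebra K A]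

/-- The linear map `1 - id` of the convolution algebra. -/
noncomputable def convJ (K A : Type*) [Field K] [CommRing A] [Bialgebra K A] :
    WithConv (A →ₗ[K] A) := 1 - toConv LinearMap.id

theorem convMul_congr {f g : WithConv (A →ₗ[K] A)} {f' g' : WithConv (A →ₗ[K] A)}
    (b : ι → A) (deg : ι → ℕ) (i : ι)
    (hb : CoalgebraStruct.comul (R := K) (b i) ∈
      Submodule.span K {x | ∃ j k, deg j + deg k = deg i ∧ x = b j ⊗ₜ[K] b k})
    (h : ∀ j k, deg j + deg k = deg i → f (b j) * g (b k) = f' (b j) * g' (b k)) :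
    (f * g) (b i) = (f' * g') (b i) := by
  rw [convMul_apply, convMul_apply]
  refine Submodule.span_induction (p := fun x _ => mul' K A (TensorProduct.map f.ofConv g.ofConv x) =
    mul' K A (TensorProduct.map f'.ofConv g'.ofConv x)) ?_ ?_ ?_ ?_ hb
  · rintro _ ⟨j, k, hjk, rfl⟩
    simpa using h j k hjk
  · simp
  · intro x y _ _ hx hy
    simp only [map_add, hx, hy]
  · intro c x _ hx
    simp only [map_smul, hx]

/-- The antipode of a bialgebra with a basis compatible with a connected grading: on a basis
element of degree `n` it is the truncated geometric series of `1 - id`. -/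
noncomputable def gradedAntipode (b : Module.Basis ι K A) (deg : ι → ℕ) : A →ₗ[K] A :=
  b.constr K fun i => (∑ k ∈ Finset.range (deg i + 1), convJ K A ^ k) (b i)

theorem convJ_one : convJ K A (1 : A) = 0 := by
  change algebraMap K A (CoalgebraStruct.counit (R := K) (1 : A)) - 1 = 0
  rw [Bialgebra.counit_one, map_one, sub_self]

theorem convJ_pow_eq_zero (b : Module.Basis ι K A) (deg : ι → ℕ)
    (h0 : ∀ i, deg i = 0 → b i = 1)
    (hb : ∀ i, CoalgebraStruct.comul (R := K) (b i) ∈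
      Submodule.span K {x | ∃ j k, deg j + deg k = deg i ∧ x = b j ⊗ₜ[K] b k}) (n : ℕ) : ∀ i, deg i < n → (convJ K A ^ n) (b i) = 0 := by
  induction n with
  | zero => intro i hi; exact (Nat.not_lt_zero _ hi).elim
  | succ n ih =>
    intro i hi
    rw [pow_succ']
    have := convMul_congr (f := convJ K A) (g := convJ K A ^ n) (f' := 0) (g' := 0)
      b deg i (hb i) (by
        intro j k hjk
        rcases Nat.eq_zero_or_pos (deg j) with hj | hj
        · rw [h0 j hj, convJ_one]; simp
        · rw [ih k (by omega)]; simp)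
    rw [this]; simp

theorem gradedAntipode_apply (b : Module.Basis ι K A) (deg : ι → ℕ)
    (h0 : ∀ i, deg i = 0 → b i = 1)
    (hb : ∀ i, CoalgebraStruct.comul (R := K) (b i) ∈
      Submodule.span K {x | ∃ j k, deg j + deg k = deg i ∧ x = b j ⊗ₜ[K] b k}) (i : ι) (n : ℕ) (hn : deg i < n) :
    gradedAntipode b deg (b i) = (∑ k ∈ Finset.range n, convJ K A ^ k) (b i) := by
  rw [gradedAntipode, Module.Basis.constr_basis]
  obtain ⟨m, rfl⟩ := Nat.exists_eq_add_of_le (Nat.succ_le_of_lt hn)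
  clear hn
  induction m with
  | zero => rfl
  | succ m ih =>
    have hs : ∑ k ∈ Finset.range ((deg i).succ + (m + 1)), convJ K A ^ k =
        ∑ k ∈ Finset.range ((deg i).succ + m), convJ K A ^ k +
          convJ K A ^ ((deg i).succ + m) := Finset.sum_range_succ _ _
    rw [hs]
    change _ = (∑ k ∈ Finset.range ((deg i).succ + m), convJ K A ^ k) (b i) +
      (convJ K A ^ ((deg i).succ + m)) (b i)
    have := convJ_pow_eq_zero b deg h0 hb ((deg i).succ + m) i (by omega)
    rw [this, add_zero, ← ih]

/-- A bialgebra with a basis compatible with a connected grading is a Hopf algebra. -/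
noncomputable abbrev gradedHopfAlgebra (b : Module.Basis ι K A) (deg : ι → ℕ)
    (h0 : ∀ i, deg i = 0 → b i = 1)
    (hb : ∀ i, CoalgebraStruct.comul (R := K) (b i) ∈
      Submodule.span K {x | ∃ j k, deg j + deg k = deg i ∧ x = b j ⊗ₜ[K] b k}) :
    HopfAlgebra K A :=
  HopfAlgebra.ofConvInverse (gradedAntipode b deg)
    (by
      apply WithConv.ext
      refine b.ext fun i => ?_
      change (toConv (gradedAntipode b deg) * toConv LinearMap.id : WithConv (A →ₗ[K] A)) (b i) =
        (1 : WithConv (A →ₗ[K] A)) (b i)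
      have h1 := convMul_congr (f := toConv (gradedAntipode b deg)) (g := toConv LinearMap.id)
        (f' := ∑ k ∈ Finset.range (deg i + 1), convJ K A ^ k)
        (g' := toConv LinearMap.id) b deg i (hb i) (by
          intro j k hjk
          rw [← gradedAntipode_apply b deg h0 hb j (deg i + 1) (by omega)])
      rw [h1, show toConv (LinearMap.id : A →ₗ[K] A) = 1 - convJ K A by simp [convJ],
        geom_sum_mul_neg]
      change _ - (convJ K A ^ (deg i + 1)) (b i) = _
      rw [convJ_pow_eq_zero b deg h0 hb (deg i + 1) i (by omega), sub_zero]
      rfl)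
    (by
      apply WithConv.ext
      refine b.ext fun i => ?_
      change (toConv LinearMap.id * toConv (gradedAntipode b deg) : WithConv (A →ₗ[K] A)) (b i) =
        (1 : WithConv (A →ₗ[K] A)) (b i)
      have h1 := convMul_congr (g := toConv (gradedAntipode b deg)) (f := toConv LinearMap.id)
        (g' := ∑ k ∈ Finset.range (deg i + 1), convJ K A ^ k)
        (f' := toConv LinearMap.id) b deg i (hb i) (by
          intro j k hjk
          rw [← gradedAntipode_apply b deg h0 hb k (deg i + 1) (by omega)])
      rw [h1, show toConv (LinearMap.id : A →ₗ[K] A) = 1 - convJ K A by simp [convJ],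
        mul_neg_geom_sum]
      change _ - (convJ K A ^ (deg i + 1)) (b i) = _
      rw [convJ_pow_eq_zero b deg h0 hb (deg i + 1) i (by omega), sub_zero]
      rfl)

end Antipode

theorem HCK.comul_mem (K : Type w) {D : Type u} [Field K] (F : Forest D) :
    CoalgebraStruct.comul (R := K) (HCK.basis K F) ∈ Submodule.span K
      {x | ∃ G H : Forest D, G.degree + H.degree = F.degree ∧
        x = HCK.basis K G ⊗ₜ[K] HCK.basis K H} := by
  induction F using Forest.ind with
  | h F =>
    rw [HCK.comul_basis]
    refine Submodule.sum_mem _ fun v _ => Submodule.subset_span ⟨_, _, ?_, rfl⟩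
    change Nat.card (F.above v.1) + Nat.card ↑(F.above v.1)ᶜ = Nat.card F.V
    rw [Nat.card_coe_set_eq, Nat.card_coe_set_eq, Set.ncard_add_ncard_compl]

noncomputable instance (K : Type w) (D : Type u) [Field K] : HopfAlgebra K (HCK K D) :=
  gradedHopfAlgebra (HCK.basis K) Forest.degree
    (fun F h => by rw [Forest.degree_eq_zero_iff.1 h, HCK.basis_one]) (HCK.comul_mem K)

/-! ## The shuffle Hopf algebra -/

/-- The vector space spanned by the `D`-words. -/
def Sh (K : Type w) (D : Type u) [Field K] : Type (max u w) := List D →₀ K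

namespace Sh

variable (K : Type w) {D : Type u} [Field K]

noncomputable instance : AddCommGroup (Sh K D) := inferInstanceAs (AddCommGroup (List D →₀ K))

noncomputable instance : Module K (Sh K D) := inferInstanceAs (Module K (List D →₀ K))

/-- The basis of words. -/
noncomputable def basis : Module.Basis (List D) K (Sh K D) := Finsupp.basisSingleOne

/-- Adding a letter in front of every word. -/
noncomputable def cons (a : D) : Sh K D →ₗ[K] Sh K D :=
  (basis K).constr K fun w => basis K (a :: w)

theorem cons_basis (a : D) (w : List D) : cons K a (basis K w) = basis K (a :: w) :=
  (basis K).constr_basis K _ _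

/-- The shuffle of two words: the sum (with multiplicities) of all the words obtained by
interleaving them. -/
noncomputable def shuffle : List D → List D → Sh K D
  | [], v => basis K v
  | a :: u, [] => basis K (a :: u)
  | a :: u, b :: v => cons K a (shuffle u (b :: v)) + cons K b (shuffle (a :: u) v)
  termination_by u v => u.length + v.length

theorem shuffle_nil_left (v : List D) : shuffle K [] v = basis K v := by
  rw [shuffle]

theorem shuffle_nil_right (u : List D) : shuffle K u [] = basis K u := by
  cases u <;> rw [shuffle]

theorem shuffle_cons_cons (a b : D) (u v : List D) : shuffle K (a :: u) (b :: v) =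
    cons K a (shuffle K u (b :: v)) + cons K b (shuffle K (a :: u) v) := by
  rw [shuffle]

/-- The shuffle product. -/
noncomputable def mulMap : Sh K D →ₗ[K] Sh K D →ₗ[K] Sh K D :=
  (basis K).constr K fun u => (basis K).constr K fun v => shuffle K u v

theorem mulMap_basis (u v : List D) : mulMap K (basis K u) (basis K v) = shuffle K u v := by
  rw [mulMap, Module.Basis.constr_basis, Module.Basis.constr_basis]

theorem mulMap_cons_cons (a b : D) (x y : Sh K D) : mulMap K (cons K a x) (cons K b y) =
    cons K a (mulMap K x (cons K b y)) + cons K b (mulMap K (cons K a x) y) := by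
  have : (mulMap K).compl₁₂ (cons K a) (cons K b) =
      ((mulMap K).compl₁₂ LinearMap.id (cons K b)).compr₂ (cons K a) +
      ((mulMap K).compl₁₂ (cons K a) LinearMap.id).compr₂ (cons K b) := by
    refine LinearMap.ext_basis (basis K) (basis K) fun u v => ?_
    simp [cons_basis, mulMap_basis, shuffle_cons_cons]
  exact LinearMap.congr_fun₂ this x y

theorem mulMap_nil_left (x : Sh K D) : mulMap K (basis K []) x = x := by
  have : mulMap K (basis K ([] : List D)) = LinearMap.id :=
    (basis K).ext fun v => by simp [mulMap_basis, shuffle_nil_left]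
  exact LinearMap.congr_fun this x

theorem shuffle_comm : ∀ u v : List D, shuffle K u v = shuffle K v u
  | [], v => by rw [shuffle_nil_left, shuffle_nil_right]
  | a :: u, [] => by rw [shuffle_nil_left, shuffle_nil_right]
  | a :: u, b :: v => by
    rw [shuffle_cons_cons, shuffle_cons_cons, shuffle_comm u, shuffle_comm (a :: u) v, add_comm]
  termination_by u v => u.length + v.length

theorem mulMap_comm (x y : Sh K D) : mulMap K x y = mulMap K y x := by
  have : mulMap K (D := D) = (mulMap K).flip :=
    LinearMap.ext_basis (basis K) (basis K) fun u v => by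
      rw [LinearMap.flip_apply, mulMap_basis, mulMap_basis, shuffle_comm]
  exact LinearMap.congr_fun₂ this x y

theorem mulMap_nil_right (x : Sh K D) : mulMap K x (basis K []) = x := by
  rw [mulMap_comm, mulMap_nil_left]

theorem mulMap_assoc_basis : ∀ u v w : List D,
    mulMap K (mulMap K (basis K u) (basis K v)) (basis K w) =
      mulMap K (basis K u) (mulMap K (basis K v) (basis K w))
  | [], v, w => by rw [mulMap_nil_left, mulMap_nil_left]
  | a :: u, [], w => by rw [mulMap_nil_left, mulMap_nil_right]
  | a :: u, b :: v, [] => by rw [mulMap_nil_right, mulMap_nil_right]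
  | a :: u, b :: v, c :: w => by
    have h1 := mulMap_assoc_basis u (b :: v) (c :: w)
    have h2 := mulMap_assoc_basis (a :: u) v (c :: w)
    have h3 := mulMap_assoc_basis (a :: u) (b :: v) w
    simp only [← cons_basis] at h1 h2 h3 ⊢
    simp only [mulMap_cons_cons, map_add, LinearMap.add_apply] at h1 h2 h3 ⊢
    have h1' := congrArg (cons K a) h1
    have h3' := congrArg (cons K c) h3
    simp only [map_add] at h1' h3'
    rw [h1', h2, ← h3']
    abel
  termination_by u v w => u.length + v.length + w.length

theorem mulMap_assoc (x y z : Sh K D) :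
    mulMap K (mulMap K x y) z = mulMap K x (mulMap K y z) := by
  have h : ∀ u v : List D, mulMap K (mulMap K (basis K u) (basis K v)) =
      mulMap K (basis K u) ∘ₗ mulMap K (basis K v) := fun u v =>
    (basis K).ext (mulMap_assoc_basis K u v)
  have h' : (mulMap K (D := D)).compr₂ (mulMap K) =
      (LinearMap.llcomp K (Sh K D) (Sh K D) (Sh K D)).compl₁₂ (mulMap K) (mulMap K) :=
    LinearMap.ext_basis (basis K) (basis K) h
  exact LinearMap.congr_fun (LinearMap.congr_fun₂ h' x y) z

noncomputable instance : CommRing (Sh K D) where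
  __ := (inferInstance : AddCommGroup (Sh K D))
  mul x y := mulMap K x y
  one := basis K []
  left_distrib x y z := map_add (mulMap K x) y z
  right_distrib x y z := by
    change mulMap K (x + y) z = _
    rw [map_add]; rfl
  zero_mul x := by
    change mulMap K 0 x = 0
    rw [map_zero]; rfl
  mul_zero x := map_zero (mulMap K x)
  mul_assoc := mulMap_assoc K
  one_mul := mulMap_nil_left K
  mul_one := mulMap_nil_right K
  mul_comm := mulMap_comm K

noncomputable instance : Algebra K (Sh K D) :=
  Algebra.ofModule (fun r x y => by
    change mulMap K (r • x) y = r • mulMap K x y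
    rw [map_smul]; rfl) (fun r x y => map_smul (mulMap K x) r y)

theorem basis_mul (u v : List D) : basis K u * basis K v = shuffle K u v := mulMap_basis K u v

theorem basis_nil : basis K ([] : List D) = 1 := rfl

theorem cons_mul_cons (a b : D) (x y : Sh K D) : cons K a x * cons K b y =
    cons K a (x * cons K b y) + cons K b (cons K a x * y) := mulMap_cons_cons K a b x y

/-- The deconcatenation of a word. -/
noncomputable def deconc (w : List D) : Sh K D ⊗[K] Sh K D :=
  ∑ i ∈ Finset.range (w.length + 1), basis K (w.take i) ⊗ₜ[K] basis K (w.drop i)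

/-- The coproduct is the deconcatenation; the counit maps the empty word to `1` and the nonempty
words to `0`. -/
noncomputable instance : CoalgebraStruct K (Sh K D) where
  comul := (basis K).constr K (deconc K)
  counit := (basis K).constr K fun w => if w.length = 0 then 1 else 0

theorem comul_basis (w : List D) :
    CoalgebraStruct.comul (R := K) (basis K w) = deconc K w := (basis K).constr_basis K _ _

theorem counit_nil : CoalgebraStruct.counit (R := K) (basis K ([] : List D)) = 1 :=
  ((basis K).constr_basis K _ _).trans (if_pos rfl)

theorem counit_cons (a : D) (w : List D) :
    CoalgebraStruct.counit (R := K) (basis K (a :: w)) = 0 :=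
  ((basis K).constr_basis K _ _).trans (if_neg (by simp))

open CoalgebraStruct

theorem comul_nil : comul (R := K) (basis K ([] : List D)) = basis K [] ⊗ₜ[K] basis K [] := by
  rw [comul_basis, deconc]; simp

theorem comul_cons_basis (a : D) (w : List D) : comul (R := K) (basis K (a :: w)) =
    basis K [] ⊗ₜ[K] basis K (a :: w) + (cons K a).rTensor _ (comul (R := K) (basis K w)) := by
  rw [comul_basis, comul_basis, deconc, deconc, List.length_cons, Finset.sum_range_succ', map_sum,
    add_comm]
  simp [cons_basis]

theorem comul_cons (a : D) (x : Sh K D) : comul (R := K) (cons K a x) =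
    basis K [] ⊗ₜ[K] cons K a x + (cons K a).rTensor _ (comul (R := K) x) := by
  have : comul (R := K) ∘ₗ cons K a = (TensorProduct.mk K _ _ (basis K [])) ∘ₗ cons K a +
      (cons K a).rTensor (Sh K D) ∘ₗ comul (R := K) :=
    (basis K).ext fun w => by simp [cons_basis, comul_cons_basis]
  exact LinearMap.congr_fun this x

noncomputable instance : Coalgebra K (Sh K D) where
  coassoc := by
    refine (basis K).ext fun w => ?_
    simp only [LinearMap.comp_apply, LinearEquiv.coe_coe]
    induction w with
    | nil => simp [comul_nil]
    | cons a w ih =>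
      have h1 : ∀ z : Sh K D ⊗[K] Sh K D, TensorProduct.assoc K _ _ _
          ((comul (R := K)).rTensor _ ((cons K a).rTensor _ z)) =
          basis K [] ⊗ₜ[K] (cons K a).rTensor _ z +
            (cons K a).rTensor _ (TensorProduct.assoc K _ _ _
              ((comul (R := K)).rTensor _ z)) := by
        have h0 : ∀ (y : Sh K D) (t : Sh K D ⊗[K] Sh K D),
            TensorProduct.assoc K _ _ _ ((cons K a).rTensor _ t ⊗ₜ[K] y) =
              (cons K a).rTensor _ (TensorProduct.assoc K _ _ _ (t ⊗ₜ[K] y)) := fun y =>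
          LinearMap.congr_fun (f := (TensorProduct.assoc K _ _ _).toLinearMap ∘ₗ
            (TensorProduct.mk K (Sh K D ⊗[K] Sh K D) (Sh K D)).flip y ∘ₗ (cons K a).rTensor _)
            (g := (cons K a).rTensor _ ∘ₗ (TensorProduct.assoc K _ _ _).toLinearMap ∘ₗ
            (TensorProduct.mk K (Sh K D ⊗[K] Sh K D) (Sh K D)).flip y)
            (TensorProduct.ext' fun _ _ => rfl)
        refine LinearMap.congr_fun (f := (TensorProduct.assoc K _ _ _).toLinearMap ∘ₗ
          (comul (R := K)).rTensor _ ∘ₗ (cons K a).rTensor _)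
          (g := TensorProduct.mk K (Sh K D) (Sh K D ⊗[K] Sh K D) (basis K []) ∘ₗ (cons K a).rTensor _ +
            (cons K a).rTensor _ ∘ₗ (TensorProduct.assoc K _ _ _).toLinearMap ∘ₗ
              (comul (R := K)).rTensor _) (TensorProduct.ext' fun x y => ?_)
        change TensorProduct.assoc K _ _ _ (comul (R := K) (cons K a x) ⊗ₜ[K] y) =
          basis K [] ⊗ₜ[K] (cons K a x ⊗ₜ[K] y) +
            (cons K a).rTensor _ (TensorProduct.assoc K _ _ _ (comul (R := K) x ⊗ₜ[K] y))
        rw [comul_cons, TensorProduct.add_tmul, map_add, TensorProduct.assoc_tmul, h0]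
      have h2 : ∀ z : Sh K D ⊗[K] Sh K D,
          (comul (R := K)).lTensor _ ((cons K a).rTensor (Sh K D) z) =
          (cons K a).rTensor _ ((comul (R := K)).lTensor _ z) :=
        LinearMap.congr_fun (f := (comul (R := K)).lTensor _ ∘ₗ (cons K a).rTensor (Sh K D))
          (g := (cons K a).rTensor _ ∘ₗ (comul (R := K)).lTensor _) (TensorProduct.ext' fun _ _ => rfl)
      rw [comul_cons_basis, map_add, map_add, map_add, h1, h2, ih, LinearMap.rTensor_tmul,
        LinearMap.lTensor_tmul, comul_nil, comul_cons_basis, TensorProduct.assoc_tmul,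
        TensorProduct.tmul_add]
      abel
  rTensor_counit_comp_comul := by
    refine (basis K).ext fun w => ?_
    simp only [LinearMap.comp_apply]
    cases w with
    | nil => simp [comul_nil, counit_nil]
    | cons a w =>
      have : (counit (R := K)).rTensor (Sh K D) ∘ₗ (cons K a).rTensor (Sh K D) = 0 := by
        rw [← LinearMap.rTensor_comp]
        have : counit (R := K) ∘ₗ cons K a = 0 :=
          (basis K).ext fun w => by simp [cons_basis, counit_cons]
        rw [this, LinearMap.rTensor_zero]
      rw [comul_cons_basis, map_add, ← LinearMap.comp_apply (LinearMap.rTensor _ _), this]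
      simp [counit_nil]
  lTensor_counit_comp_comul := by
    refine (basis K).ext fun w => ?_
    simp only [LinearMap.comp_apply]
    induction w with
    | nil => simp [comul_nil, counit_nil]
    | cons a w ih =>
      have h2 : ∀ z : Sh K D ⊗[K] Sh K D,
          (counit (R := K)).lTensor _ ((cons K a).rTensor (Sh K D) z) =
          (cons K a).rTensor _ ((counit (R := K)).lTensor _ z) :=
        LinearMap.congr_fun (f := (counit (R := K)).lTensor _ ∘ₗ (cons K a).rTensor (Sh K D))
          (g := (cons K a).rTensor _ ∘ₗ (counit (R := K)).lTensor _)
          (TensorProduct.ext' fun _ _ => rfl)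
      rw [comul_cons_basis, map_add, h2, ih]
      simp [counit_cons, cons_basis]

theorem rTensor_mul (a b : D) (x y : Sh K D ⊗[K] Sh K D) :
    (cons K a).rTensor _ x * (cons K b).rTensor _ y =
      (cons K a).rTensor _ (x * (cons K b).rTensor _ y) +
      (cons K b).rTensor _ ((cons K a).rTensor _ x * y) := by
  induction x with
  | zero => simp
  | add x x' hx hx' => simp only [map_add, add_mul, hx, hx']; abel
  | tmul p q =>
    induction y with
    | zero => simp
    | add x x' hx hx' => simp only [map_add, mul_add, hx, hx']; abel
    | tmul r s =>
      simp only [LinearMap.rTensor_tmul, Algebra.TensorProduct.tmul_mul_tmul, cons_mul_cons,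
        TensorProduct.add_tmul]

theorem rTensor_mul_right (a : D) (x : Sh K D ⊗[K] Sh K D) (y : Sh K D) :
    (cons K a).rTensor _ x * (1 ⊗ₜ[K] y) = (cons K a).rTensor _ (x * (1 ⊗ₜ[K] y)) := by
  induction x with
  | zero => simp
  | add x x' hx hx' => simp only [map_add, add_mul, hx, hx']
  | tmul p q => simp [Algebra.TensorProduct.tmul_mul_tmul]

theorem comul_mul_basis : ∀ u v : List D, comul (R := K) (basis K u * basis K v) =
    comul (R := K) (basis K u) * comul (R := K) (basis K v)
  | [], v => by rw [comul_nil, basis_nil, ← Algebra.TensorProduct.one_def, one_mul, one_mul]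
  | a :: u, [] => by rw [comul_nil, basis_nil, ← Algebra.TensorProduct.one_def, mul_one, mul_one]
  | a :: u, b :: v => by
    have h1 := comul_mul_basis u (b :: v)
    have h2 := comul_mul_basis (a :: u) v
    simp only [← cons_basis] at h1 h2 ⊢
    rw [cons_mul_cons, map_add, comul_cons, comul_cons, h1, h2]
    simp only [comul_cons, basis_nil, mul_add, add_mul, map_add, rTensor_mul, rTensor_mul_right,
      Algebra.TensorProduct.tmul_mul_tmul, cons_mul_cons, one_mul, TensorProduct.tmul_add]
    rw [mul_comm (1 ⊗ₜ[K] cons K a (basis K u)) ((cons K b).rTensor _ _), rTensor_mul_right,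
      mul_comm _ (1 ⊗ₜ[K] cons K a (basis K u))]
    abel
  termination_by u v => u.length + v.length

theorem counit_mul_basis (u v : List D) : counit (R := K) (basis K u * basis K v) =
    counit (R := K) (basis K u) * counit (R := K) (basis K v) := by
  cases u with
  | nil => rw [counit_nil, basis_nil, one_mul, one_mul]
  | cons a u =>
    cases v with
    | nil => rw [counit_nil, basis_nil, mul_one, mul_one]
    | cons b v =>
      have : ∀ (c : D) (x : Sh K D), counit (R := K) (cons K c x) = 0 := fun c x =>
        LinearMap.congr_fun (show counit (R := K) ∘ₗ cons K c = 0 from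
          (basis K).ext fun w => by simp [cons_basis, counit_cons]) x
      rw [basis_mul, shuffle_cons_cons, map_add, this, this, counit_cons, zero_mul, add_zero]

noncomputable instance : Bialgebra K (Sh K D) where
  counit_one := counit_nil K
  mul_compr₂_counit := LinearMap.ext_basis (basis K) (basis K) (counit_mul_basis K)
  comul_one := comul_nil K
  mul_compr₂_comul := LinearMap.ext_basis (basis K) (basis K) (comul_mul_basis K)

theorem comul_mem (w : List D) :
    comul (R := K) (basis K w) ∈ Submodule.span K
      {x | ∃ u v : List D, u.length + v.length = w.length ∧ x = basis K u ⊗ₜ[K] basis K v} := by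
  rw [comul_basis]
  refine Submodule.sum_mem _ fun i _ => Submodule.subset_span ⟨_, _, ?_, rfl⟩
  rw [← List.length_append, List.take_append_drop]

noncomputable instance : HopfAlgebra K (Sh K D) :=
  gradedHopfAlgebra (basis K) List.length
    (fun w h => by rw [List.length_eq_zero_iff.1 h, basis_nil]) (comul_mem K)

end Sh

/-! ## The maps of the diagram -/

/-- The inclusion `i` of the space spanned by the nonempty trees in the space spanned by the
forests. -/
noncomputable def treeIncl (K : Type w) (D : Type u) [Field K] : (Tree D →₀ K) →ₗ[K] HCK K D :=
  Finsupp.linearCombination K fun T => HCK.basis K T.1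

/-- The projection `π` on the words with exactly one letter: a word `(a)` is mapped to `a` and
the words whose number of letters is not one are mapped to zero. -/
noncomputable def letterProj (K : Type w) (D : Type u) [Field K] : Sh K D →ₗ[K] (D →₀ K) :=
  (Sh.basis K).constr K fun w : List D => match w with
    | [a] => Finsupp.single a (1 : K)
    | _ => 0

end CutShuffle

namespace CutShuffle

open LinearMap WithConv Coalgebra

universe u w

/-! ### Word coefficients and convolution -/

namespace Sh

variable {K : Type w} {D : Type u} [Field K]

/-! The shuffle coalgebra is cofree among connected graded coalgebras. Deconcatenation is dual to
concatenation (`coord_convMul`), so for a coalgebra morphism `Φ` the coefficient of the word `a₁⋯aₙ`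
in `Φ` is the convolution product of the linear forms `g_{a₁}, …, g_{aₙ}`, where `g_a` is the
`a`-component of `g = π ∘ Φ`. Hence `Φ` is determined by `g` (`Sh.coalgHom_ext`). Conversely, any
`g` vanishing in degree `0` arises in this way (`Sh.exists_coalgHom`): a convolution product of `n`
such forms vanishes in degrees below `n`, so the sum over all words is finite on each basis element.

The product enters through a Leibniz rule: `π(xy) = ε(x)π(y) + ε(y)π(x)` in the shuffle algebra,
because a shuffle of two nonempty words has at least two letters (`Sh.letterProj_mul`). So for a
bialgebra morphism `Φ`, the map `π ∘ Φ` kills `1` and the products of two nonempty forests. Every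
forest is empty, a tree, or such a product, so `π ∘ Φ` must be the extension of `φ` by zero; this
gives uniqueness.

For existence, let `g` be this extension by zero and `Φ` the coalgebra morphism it defines. A
product of two nonempty forests is never a tree, so `g` obeys the same Leibniz rule
(`HCK.extendByZero_mul`). Then `x ⊗ y ↦ Φ(x)Φ(y)` and `x ⊗ y ↦ Φ(xy)` are coalgebra morphisms with
the same one-letter component, hence equal. Antipodes need no separate treatment: a bialgebra
morphism between Hopf algebras commutes with them. -/

theorem coord_basis (u v : List D) [Decidable (v = u)] :
    (basis K).coord u (basis K v) = if v = u then 1 else 0 := by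
  classical
  rw [Module.Basis.coord_apply, Module.Basis.repr_self, Finsupp.single_apply]

/-- Identifies the coefficient of the empty word with the unit of the convolution algebra, the base
case of inductions on words. -/
theorem coord_nil : (basis K).coord ([] : List D) = counit (R := K) := by
  classical
  refine (basis K).ext fun w => ?_
  cases w with
  | nil => rw [coord_basis, counit_nil, if_pos rfl]
  | cons a w => rw [coord_basis, counit_cons, if_neg (by simp)]

/-- Deconcatenation is dual to the concatenation of words. -/
theorem coord_convMul (u v : List D) :
    toConv ((basis K).coord u) * toConv ((basis K).coord v) =
      toConv ((basis K).coord (u ++ v)) := by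
  classical
  refine WithConv.ext ((basis K).ext fun w => ?_)
  change (toConv ((basis K).coord u) * toConv ((basis K).coord v)) (basis K w) = _
  rw [convMul_apply, comul_basis, deconc, map_sum, map_sum]
  simp only [TensorProduct.map_tmul, mul'_apply, coord_basis]
  split_ifs with h
  · subst h
    -- Among the cuts of `u ++ v`, only the one after `u.length` letters has left part `u`.
    rw [Finset.sum_eq_single u.length]
    · simp
    · intro i hi hne
      rw [if_neg, zero_mul]
      intro h
      have := congrArg List.length h
      simp only [List.length_take, Finset.mem_range] at this hi
      omega
    · intro h
      simp at h
  · refine Finset.sum_eq_zero fun i _ => ?_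
    by_cases h1 : w.take i = u
    · have h2 : w.drop i ≠ v := fun h2 => h (by rw [← h1, ← h2, List.take_append_drop])
      rw [if_neg h2, mul_zero]
    · rw [if_neg h1, zero_mul]

theorem letterProj_apply (x : Sh K D) (a : D) :
    letterProj K D x a = (basis K).coord [a] x := by
  classical
  have : Finsupp.lapply a ∘ₗ letterProj K D = (basis K).coord [a] := by
    refine (basis K).ext fun w => ?_
    rw [LinearMap.comp_apply, letterProj, Module.Basis.constr_basis, coord_basis]
    rcases w with _ | ⟨b, _ | ⟨c, w⟩⟩
    · simp
    · simp [Finsupp.single_apply]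
    · simp
  exact LinearMap.congr_fun this x

/-- Splitting off the first letter expresses every word coefficient, by induction, through
`letterProj` and convolution alone. -/
theorem coord_cons (a : D) (w : List D) : toConv ((basis K).coord (a :: w)) =
    toConv (Finsupp.lapply a ∘ₗ letterProj K D) * toConv ((basis K).coord w) := by
  have : Finsupp.lapply a ∘ₗ letterProj K D = (basis K).coord [a] :=
    LinearMap.ext fun x => letterProj_apply x a
  rw [this, coord_convMul, List.singleton_append]

theorem ext_coord {x y : Sh K D} (h : ∀ w, (basis K).coord w x = (basis K).coord w y) : x = y :=
  (basis K).ext_elem h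

/-- Elements of the tensor square are determined by the products of word coefficients. -/
theorem tensor_ext_coord {x y : Sh K D ⊗[K] Sh K D}
    (h : ∀ u v, mul' K K (TensorProduct.map ((basis K).coord u) ((basis K).coord v) x) =
      mul' K K (TensorProduct.map ((basis K).coord u) ((basis K).coord v) y)) : x = y := by
  -- These products are the coordinates in the tensor product basis.
  have key : ∀ (z : Sh K D ⊗[K] Sh K D) (u v : List D),
      ((basis K).tensorProduct (basis K)).repr z (u, v) =
        mul' K K (TensorProduct.map ((basis K).coord u) ((basis K).coord v) z) := by
    intro z u v
    induction z with
    | zero => simp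
    | add x y hx hy => simp only [map_add, Finsupp.add_apply, hx, hy]
    | tmul x y => simp [mul_comm]
  refine ((basis K).tensorProduct (basis K)).ext_elem fun ⟨u, v⟩ => ?_
  rw [key, key, h]

/-! ### Cofreeness of the shuffle coalgebra -/

section Coalgebra

variable {A : Type*} [AddCommGroup A] [Module K A] [Coalgebra K A]

/-- A coalgebra morphism to the shuffle coalgebra is determined by its one-letter component. -/
theorem coalgHom_ext {Φ Ψ : A →ₗc[K] Sh K D}
    (h : ∀ x, letterProj K D (Φ x) = letterProj K D (Ψ x)) : Φ = Ψ := by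
  have key : ∀ w : List D, (basis K).coord w ∘ₗ Φ.toLinearMap =
      (basis K).coord w ∘ₗ Ψ.toLinearMap := by
    intro w
    induction w with
    | nil => rw [coord_nil, Φ.counit_comp, Ψ.counit_comp]
    | cons a w ih =>
      have hc := coord_cons (K := K) a w
      -- Precomposition with a coalgebra morphism respects convolution, so the coefficient of `a ::
      -- w` in `Φ` is the convolution of the `a`-component of `π ∘ Φ` with the coefficient of `w`.
      have h1 := convMul_comp_coalgHom_distrib (toConv (Finsupp.lapply a ∘ₗ letterProj K D))
        (toConv ((basis K).coord w)) Φ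
      have h2 := convMul_comp_coalgHom_distrib (toConv (Finsupp.lapply a ∘ₗ letterProj K D))
        (toConv ((basis K).coord w)) Ψ
      rw [← hc] at h1 h2
      have h3 : (Finsupp.lapply a ∘ₗ letterProj K D) ∘ₗ Φ.toLinearMap =
          (Finsupp.lapply a ∘ₗ letterProj K D) ∘ₗ Ψ.toLinearMap :=
        LinearMap.ext fun x => DFunLike.congr_fun (h x) a
      refine h1.trans (Eq.trans ?_ h2.symm)
      simp only [ih, h3]
  exact CoalgHom.ext fun x => ext_coord fun w => LinearMap.congr_fun (key w) x

/-- Prefixing words by linear combinations of letters. -/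
noncomputable def consLin : (D →₀ K) →ₗ[K] Sh K D →ₗ[K] Sh K D :=
  Finsupp.linearCombination K (cons K)

theorem coord_cons_consLin (a : D) (u : List D) (p : D →₀ K) (x : Sh K D) :
    (basis K).coord (a :: u) (consLin p x) = p a * (basis K).coord u x := by
  classical
  induction p using Finsupp.induction_linear with
  | zero => simp
  | add p q hp hq => simp only [map_add, LinearMap.add_apply, hp, hq, Finsupp.add_apply, add_mul]
  | single b c =>
    have : (basis K).coord (a :: u) ∘ₗ cons K b = (if b = a then 1 else 0 : K) •
        (basis K).coord u := by
      refine (basis K).ext fun v => ?_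
      rw [LinearMap.comp_apply, cons_basis, coord_basis, LinearMap.smul_apply, coord_basis]
      simp only [List.cons.injEq]
      split_ifs <;> simp_all
    have h := LinearMap.congr_fun this x
    simp only [LinearMap.comp_apply, LinearMap.smul_apply] at h
    simp only [consLin, Finsupp.linearCombination_single, LinearMap.smul_apply, map_smul, h,
      Finsupp.single_apply, smul_eq_mul]
    split_ifs <;> simp

theorem coord_nil_consLin (p : D →₀ K) (x : Sh K D) :
    (basis K).coord [] (consLin p x) = 0 := by
  classical
  induction p using Finsupp.induction_linear with
  | zero => simp
  | add p q hp hq => simp only [map_add, LinearMap.add_apply, hp, hq, add_zero]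
  | single b c =>
    have : (basis K).coord [] ∘ₗ cons K b = 0 :=
      (basis K).ext fun v => by
        rw [LinearMap.comp_apply, cons_basis, coord_basis, if_neg (by simp)]; rfl
    have h := LinearMap.congr_fun this x
    simp only [LinearMap.comp_apply] at h
    simp [consLin, h]

/-- The coefficient of the word `a₁ ⋯ aₙ` in the coalgebra morphism with one-letter component `g`
is the convolution product of the coefficients of `g`. -/
noncomputable def wordCoeff (g : A →ₗ[K] D →₀ K) (w : List D) : WithConv (A →ₗ[K] K) :=
  (w.map fun a => toConv (Finsupp.lapply a ∘ₗ g)).prod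

theorem wordCoeff_nil (g : A →ₗ[K] D →₀ K) : wordCoeff g [] = toConv (counit (R := K)) := rfl

theorem wordCoeff_cons (g : A →ₗ[K] D →₀ K) (a : D) (w : List D) :
    wordCoeff g (a :: w) = toConv (Finsupp.lapply a ∘ₗ g) * wordCoeff g w := by
  simp [wordCoeff]

theorem wordCoeff_append (g : A →ₗ[K] D →₀ K) (u v : List D) :
    wordCoeff g (u ++ v) = wordCoeff g u * wordCoeff g v := by
  simp [wordCoeff]

/-- The truncation, at words of length at most `n`, of the coalgebra morphism with one-letter
component `g`. -/
noncomputable def truncLift (g : A →ₗ[K] D →₀ K) : ℕ → A →ₗ[K] Sh K D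
  | 0 => (LinearMap.toSpanSingleton K _ 1) ∘ₗ counit
  -- A word is empty or a letter followed by a word, so the full lift is a fixed point of `Φ ↦ ε(·)1
  -- + consLin ∘ (g ⊗ Φ) ∘ Δ`; the truncations iterate this map.
  | n + 1 => (LinearMap.toSpanSingleton K _ 1) ∘ₗ counit +
      TensorProduct.lift consLin ∘ₗ TensorProduct.map g (truncLift g n) ∘ₗ comul

/-- Each step of the recursion peels off the first letter of the word and contributes one
convolution factor; the induction is on `w` with `n` free, since both decrease together. -/
theorem coord_truncLift (g : A →ₗ[K] D →₀ K) (w : List D) : ∀ (n : ℕ) (x : A),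
    (basis K).coord w (truncLift g n x) = if w.length ≤ n then (wordCoeff g w) x else 0 := by
  classical
  have hone : ∀ w : List D, (basis K).coord w (1 : Sh K D) = if [] = w then 1 else 0 := fun w =>
    (congrArg _ (basis_nil K).symm).trans (coord_basis w [])
  induction w with
  | nil =>
    intro n x
    rw [if_pos (by simp), wordCoeff_nil]
    change _ = counit (R := K) x
    cases n with
    | zero => simp only [truncLift, LinearMap.comp_apply, toSpanSingleton_apply, map_smul, hone]; simp
    | succ n =>
      have h0 : ∀ z : (D →₀ K) ⊗[K] Sh K D,
          (basis K).coord [] (TensorProduct.lift consLin z) = 0 := by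
        intro z
        induction z with
        | zero => simp
        | add x y hx hy => simp only [map_add, hx, hy, add_zero]
        | tmul p y => rw [TensorProduct.lift.tmul, coord_nil_consLin]
      simp only [truncLift, LinearMap.comp_apply, LinearMap.add_apply, toSpanSingleton_apply,
        map_add, map_smul, hone, h0]
      simp
  | cons a w ih =>
    intro n x
    cases n with
    | zero =>
      simp only [truncLift, LinearMap.comp_apply, toSpanSingleton_apply, map_smul, hone]
      simp
    | succ n =>
      have h0 : ∀ z : A ⊗[K] A, (basis K).coord (a :: w) (TensorProduct.lift consLin
          (TensorProduct.map g (truncLift g n) z)) = if w.length ≤ n then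
            mul' K K (TensorProduct.map (Finsupp.lapply a ∘ₗ g) (wordCoeff g w).ofConv z)
            else 0 := by
        intro z
        induction z with
        | zero => simp
        | add x y hx hy =>
          simp only [map_add, hx, hy]
          split_ifs <;> simp
        | tmul p y =>
          rw [TensorProduct.map_tmul, TensorProduct.lift.tmul, coord_cons_consLin, ih]
          split_ifs
          · rfl
          · simp
      simp only [truncLift, LinearMap.comp_apply, LinearMap.add_apply, toSpanSingleton_apply,
        map_add, map_smul, hone, h0, wordCoeff_cons, convMul_apply]
      simp

variable {ι : Type*} (b : Module.Basis ι K A) (deg : ι → ℕ) (g : A →ₗ[K] D →₀ K)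

/-- Local finiteness: when a total degree less than the number of factors is distributed among them,
some factor receives degree `0`, where `g` vanishes. -/
theorem wordCoeff_eq_zero
    (hb : ∀ i, comul (R := K) (b i) ∈
      Submodule.span K {x | ∃ j k, deg j + deg k = deg i ∧ x = b j ⊗ₜ[K] b k})
    (hg : ∀ i, deg i = 0 → g (b i) = 0) (w : List D) :
    ∀ i, deg i < w.length → (wordCoeff g w) (b i) = 0 := by
  induction w with
  | nil => intro i hi; exact (Nat.not_lt_zero _ hi).elim
  | cons a w ih =>
    intro i hi
    rw [wordCoeff_cons, convMul_apply]
    refine Submodule.span_induction (p := fun x _ => mul' K K (TensorProduct.map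
      (Finsupp.lapply a ∘ₗ g) (wordCoeff g w).ofConv x) = 0) ?_ (by simp) ?_ ?_ (hb i)
    · rintro _ ⟨j, k, hjk, rfl⟩
      rw [TensorProduct.map_tmul, mul'_apply]
      rcases Nat.eq_zero_or_pos (deg j) with hj | hj
      · rw [LinearMap.comp_apply, hg j hj, map_zero, zero_mul]
      -- The first factor takes degree at least `1`, leaving `k` a degree less than the length of
      -- `w`.
      · refine mul_eq_zero_of_right _ (ih k ?_)
        rw [List.length_cons] at hi
        omega
    · intro x y _ _ hx hy
      rw [map_add, map_add, hx, hy, add_zero]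
    · intro c x _ hx
      rw [map_smul, map_smul, hx, smul_zero]

/-- A linear map from a coalgebra with a basis compatible with a connected grading to the shuffle
coalgebra, whose coefficients are the maps `wordCoeff g w`. -/
noncomputable def liftLin : A →ₗ[K] Sh K D := b.constr K fun i => truncLift g (deg i) (b i)

variable {b deg g}

/-- Truncating at the degree of a basis element loses nothing: the coefficients of longer words
vanish there by `wordCoeff_eq_zero`. -/
theorem coord_liftLin
    (hb : ∀ i, comul (R := K) (b i) ∈
      Submodule.span K {x | ∃ j k, deg j + deg k = deg i ∧ x = b j ⊗ₜ[K] b k})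
    (hg : ∀ i, deg i = 0 → g (b i) = 0) (w : List D) :
    (basis K).coord w ∘ₗ liftLin b deg g = (wordCoeff g w).ofConv := by
  refine b.ext fun i => ?_
  rw [LinearMap.comp_apply, liftLin, Module.Basis.constr_basis, coord_truncLift]
  split_ifs with h
  · rfl
  · exact (wordCoeff_eq_zero b deg g hb hg w i (not_le.1 h)).symm

/-- Cofreeness of the shuffle coalgebra among the connected graded coalgebras. -/
theorem exists_coalgHom
    (hb : ∀ i, comul (R := K) (b i) ∈
      Submodule.span K {x | ∃ j k, deg j + deg k = deg i ∧ x = b j ⊗ₜ[K] b k})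
    (hg : ∀ i, deg i = 0 → g (b i) = 0) :
    ∃ Φ : A →ₗc[K] Sh K D, ∀ x, letterProj K D (Φ x) = g x := by
  have hc := coord_liftLin hb hg
  refine ⟨{ liftLin b deg g with
      counit_comp := ?_
      map_comp_comul := ?_ }, fun x => ?_⟩
  · rw [← coord_nil]
    exact hc []
  · refine LinearMap.ext fun x => tensor_ext_coord fun u v => ?_
    -- Paired with words `u` and `v`, both sides of the compatibility with `Δ` give the coefficient
    -- of `u ++ v`: one by `coord_convMul`, the other because `wordCoeff` turns concatenation into
    -- convolution.
    have h1 : mul' K K (TensorProduct.map ((basis K).coord u) ((basis K).coord v)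
        (comul (R := K) (liftLin b deg g x))) = (basis K).coord (u ++ v) (liftLin b deg g x) :=
      LinearMap.congr_fun (congrArg WithConv.ofConv (coord_convMul u v)) _
    have h2 : mul' K K (TensorProduct.map (wordCoeff g u).ofConv (wordCoeff g v).ofConv
        (comul (R := K) x)) = (wordCoeff g (u ++ v)).ofConv x := by
      rw [wordCoeff_append]; rfl
    refine Eq.trans ?_ h1.symm
    rw [← LinearMap.comp_apply ((basis K).coord (u ++ v)), hc, ← h2, ← hc, ← hc,
      TensorProduct.map_comp]
    rfl
  · ext a
    rw [letterProj_apply]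
    refine (LinearMap.congr_fun (hc [a]) x).trans ?_
    simp [wordCoeff]

end Coalgebra

/-! ### The Leibniz rule for one-letter components -/

theorem letterProj_one : letterProj K D (1 : Sh K D) = 0 :=
  (congrArg _ (basis_nil K).symm).trans ((basis K).constr_basis K _ _)

/-- A shuffle of two nonempty words has at least two letters. -/
theorem letterProj_mul (x y : Sh K D) : letterProj K D (x * y) =
    counit (R := K) x • letterProj K D y + counit (R := K) y • letterProj K D x := by
  classical
  -- The one-letter part of `cons K a z` is `ε(z)` times the letter `a`.
  have h0 : ∀ (a : D) (z : Sh K D), counit (R := K) z = 0 → letterProj K D (cons K a z) = 0 := by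
    intro a z hz
    have : letterProj K D ∘ₗ cons K a =
        (LinearMap.toSpanSingleton K _ (Finsupp.single a 1)) ∘ₗ counit := by
      refine (basis K).ext fun w => ?_
      rw [LinearMap.comp_apply, LinearMap.comp_apply, cons_basis, letterProj,
        Module.Basis.constr_basis]
      cases w with
      | nil => rw [counit_nil]; simp
      | cons b w => rw [counit_cons]; simp
    have h := LinearMap.congr_fun this z
    simpa [hz] using h
  have : (LinearMap.mul K (Sh K D)).compr₂ (letterProj K D) =
      (LinearMap.lsmul K (D →₀ K)).compl₁₂ counit (letterProj K D) +
      ((LinearMap.lsmul K (D →₀ K)).compl₁₂ counit (letterProj K D)).flip := by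
    refine LinearMap.ext_basis (basis K) (basis K) fun u v => ?_
    change letterProj K D (basis K u * basis K v) =
      counit (R := K) (basis K u) • letterProj K D (basis K v) +
        counit (R := K) (basis K v) • letterProj K D (basis K u)
    cases u with
    | nil => rw [counit_nil, basis_nil, one_mul, letterProj_one, smul_zero, add_zero, one_smul]
    | cons a u =>
      cases v with
      | nil => rw [counit_nil, basis_nil, mul_one, letterProj_one, smul_zero, zero_add, one_smul]
      | cons b v =>
        -- In both terms of the shuffle recursion, the product behind the first letter still has a
        -- nonempty factor, so its counit is zero and `h0` applies.
        rw [counit_cons, counit_cons, zero_smul, zero_smul, add_zero, ← cons_basis, ← cons_basis,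
          cons_mul_cons, map_add, h0, h0, add_zero]
        · rw [cons_basis, Bialgebra.counit_mul, counit_cons, zero_mul]
        · rw [cons_basis, Bialgebra.counit_mul, counit_cons, mul_zero]
  exact LinearMap.congr_fun₂ this x y

end Sh

/-! ### Trees and products of forests -/

namespace Forest

variable {D : Type u}

theorem not_isTree_one : ¬ (1 : Forest D).IsTree := fun ⟨r, _⟩ => (r : Empty).elim

/-- A path stays on its side of a disjoint union, so no vertex can be reached from both sides. -/
theorem not_isTree_mul {F G : Forest D} (hF : F ≠ 1) (hG : G ≠ 1) : ¬ (F * G).IsTree := by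
  induction F using ind with
  | h F =>
  induction G using ind with
  | h G =>
  have hF' : Nonempty F.V := not_isEmpty_iff.1 fun _ => hF mk_eq_one
  have hG' : Nonempty G.V := not_isEmpty_iff.1 fun _ => hG mk_eq_one
  rintro ⟨r, hr⟩
  have key : ∀ x : (F.disjUnion G).V, (F.disjUnion G).Reach x r →
      (Sum.isLeft x = Sum.isLeft r) := by
    intro x hx
    induction hx using Relation.ReflTransGen.head_induction_on with
    | refl => rfl
    | @head a c h _ ih =>
      rw [← ih]
      rcases a with a | a <;> rcases c with c | c
      exacts [rfl, h.elim, h.elim, rfl]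
  have h1 := key (Sum.inl hF'.some) (hr _)
  have h2 := key (Sum.inr hG'.some) (hr _)
  rw [← h2] at h1
  cases h1

theorem eq_mul_restrict (F : DecForest D) (S : Set F.V) (hS : ∀ v w, F.Edge v w → (v ∈ S ↔ w ∈ S)) :
    mk F = mk (F.restrict S) * mk (F.restrict Sᶜ) := by
  classical
  refine (mk_eq ⟨Equiv.Set.sumCompl S, ?_, ?_⟩ : mk ((F.restrict S).disjUnion (F.restrict Sᶜ)) =
    mk F).symm
  · rintro (⟨v, hv⟩ | ⟨v, hv⟩) (⟨w, hw⟩ | ⟨w, hw⟩)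
    · exact Iff.rfl
    · exact ⟨fun h => hw ((hS _ _ h).1 hv), False.elim⟩
    · exact ⟨fun h => hv ((hS _ _ h).2 hw), False.elim⟩
    · exact Iff.rfl
  · rintro (⟨v, hv⟩ | ⟨v, hv⟩) <;> rfl

/-- A forest is empty, a tree, or the disjoint union of two nonempty forests. -/
theorem eq_one_or_isTree_or_eq_mul (F : Forest D) :
    F = 1 ∨ F.IsTree ∨ ∃ G H : Forest D, G ≠ 1 ∧ H ≠ 1 ∧ F = G * H := by
  induction F using ind with
  | h F =>
  by_cases hF : IsEmpty F.V
  · exact .inl mk_eq_one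
  refine .inr (or_iff_not_imp_left.2 fun hT => ?_)
  obtain ⟨v⟩ := not_isEmpty_iff.1 hF
  -- Here `r` is a root: it reaches no vertex but itself. Its component `S` is split off.
  obtain ⟨r, -, -, hr⟩ := DecForest.exists_minimal (Set.mem_univ v)
  set S : Set F.V := {x | F.Reach x r} with hS
  have hrS : r ∈ S := Relation.ReflTransGen.refl
  refine ⟨mk (F.restrict S), mk (F.restrict Sᶜ), HCK.mk_restrict_ne_one ?_,
    HCK.mk_restrict_ne_one ?_, eq_mul_restrict F S fun a c h => ⟨fun ha => ?_, fun hc => ?_⟩⟩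
  · exact Set.nonempty_iff_ne_empty.1 ⟨r, hrS⟩
  · intro h
    rw [Set.compl_empty_iff] at h
    exact hT ⟨r, fun x => (h ▸ Set.mem_univ x : x ∈ S)⟩
  -- For an edge from `a` to `c` with `a` in `S`: if `a` is the root, then `c` equals it; otherwise
  -- the path from `a` to `r` starts with the only edge leaving `a`, so it passes through `c`.
  · rcases Relation.ReflTransGen.cases_head ha with rfl | ⟨d, hd, hdr⟩
    · have := hr c (Set.mem_univ c) (.single h)
      subst this
      exact hrS
    · exact F.edge_unique h hd ▸ hdr
  · exact Relation.ReflTransGen.head h hc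

end Forest

/-! ### Bialgebra morphisms from the Connes–Kreimer algebra -/

namespace HCK

variable {K : Type w} {D : Type u} [Field K]

theorem treeIncl_single (T : Tree D) : treeIncl K D (Finsupp.single T 1) = basis K T.1 := by
  simp [treeIncl]

open Classical in
/-- The extension by zero to all the forests of a linear map defined on the trees. -/
noncomputable def extendByZero {M : Type*} [AddCommGroup M] [Module K M]
    (φ : (Tree D →₀ K) →ₗ[K] M) : HCK K D →ₗ[K] M :=
  (basis K).constr K fun F => if h : F.IsTree then φ (Finsupp.single ⟨F, h⟩ 1) else 0

section

variable {M : Type*} [AddCommGroup M] [Module K M] (φ : (Tree D →₀ K) →ₗ[K] M)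

theorem extendByZero_of_isTree {F : Forest D} (h : F.IsTree) :
    extendByZero φ (basis K F) = φ (Finsupp.single ⟨F, h⟩ 1) :=
  ((basis K).constr_basis K _ _).trans (dif_pos h)

theorem extendByZero_of_not_isTree {F : Forest D} (h : ¬ F.IsTree) :
    extendByZero φ (basis K F) = 0 :=
  ((basis K).constr_basis K _ _).trans (dif_neg h)

theorem extendByZero_comp_treeIncl : extendByZero φ ∘ₗ treeIncl K D = φ := by
  refine Finsupp.lhom_ext' fun T => LinearMap.ext_ring ?_
  simp only [LinearMap.comp_apply, Finsupp.lsingle_apply, treeIncl_single]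
  exact extendByZero_of_isTree φ T.2

/-- On two nonempty forests both sides vanish, since their product is not a tree. This matches
`Sh.letterProj_mul` and makes the lift multiplicative. -/
theorem extendByZero_mul (x y : HCK K D) : extendByZero φ (x * y) =
    counit (R := K) x • extendByZero φ y + counit (R := K) y • extendByZero φ x := by
  have h1 : extendByZero φ (1 : HCK K D) = 0 :=
    (congrArg _ (basis_one K).symm).trans (extendByZero_of_not_isTree φ Forest.not_isTree_one)
  have : (LinearMap.mul K (HCK K D)).compr₂ (extendByZero φ) =
      (LinearMap.lsmul K M).compl₁₂ counit (extendByZero φ) +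
      ((LinearMap.lsmul K M).compl₁₂ counit (extendByZero φ)).flip := by
    refine LinearMap.ext_basis (basis K) (basis K) fun F G => ?_
    change extendByZero φ (basis K F * basis K G) =
      counit (R := K) (basis K F) • extendByZero φ (basis K G) +
        counit (R := K) (basis K G) • extendByZero φ (basis K F)
    by_cases hF : F = 1
    · rw [hF, counit_basis_one, basis_one, one_mul, h1, smul_zero, add_zero, one_smul]
    by_cases hG : G = 1
    · rw [hG, counit_basis_one, basis_one, mul_one, h1, smul_zero, zero_add, one_smul]
    rw [counit_basis K hF, counit_basis K hG, zero_smul, zero_smul, add_zero, basis_mul,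
      extendByZero_of_not_isTree φ (Forest.not_isTree_mul hF hG)]
  exact LinearMap.congr_fun₂ this x y

end

/-- The one-letter component of a bialgebra morphism is determined by its values on the trees. -/
theorem letterProj_comp_eq_extendByZero {φ : (Tree D →₀ K) →ₗ[K] D →₀ K}
    (Φ : HCK K D →ₐc[K] Sh K D)
    (h : letterProj K D ∘ₗ (Φ : HCK K D →ₗ[K] Sh K D) ∘ₗ treeIncl K D = φ) (x : HCK K D) :
    letterProj K D (Φ x) = extendByZero φ x := by
  suffices hs : letterProj K D ∘ₗ (Φ : HCK K D →ₗ[K] Sh K D) = extendByZero φ from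
    LinearMap.congr_fun hs x
  refine (basis K).ext fun F => ?_
  change letterProj K D (Φ (basis K F)) = _
  have hcounit : ∀ y, counit (R := K) (Φ y) = counit (R := K) y := fun y =>
    CoalgHomClass.counit_comp_apply Φ y
  -- Only the tree case carries information: by the Leibniz rule and preservation of the counit, `π
  -- ∘ Φ` kills `1` and products of nonempty forests.
  rcases Forest.eq_one_or_isTree_or_eq_mul F with rfl | hF | ⟨G, H, hG, hH, rfl⟩
  · rw [extendByZero_of_not_isTree φ Forest.not_isTree_one, basis_one, map_one, Sh.letterProj_one]
  · rw [extendByZero_of_isTree φ hF, ← h]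
    simp only [LinearMap.comp_apply, treeIncl_single]
    rfl
  · rw [extendByZero_of_not_isTree φ (Forest.not_isTree_mul hG hH), ← basis_mul, map_mul,
      Sh.letterProj_mul, hcounit, hcounit, counit_basis K hG, counit_basis K hH, zero_smul,
      zero_smul, add_zero]

/-- The extension by zero of a linear map defined on the trees is the one-letter component of a
bialgebra morphism. -/
theorem exists_bialgHom (φ : (Tree D →₀ K) →ₗ[K] D →₀ K) :
    ∃ Φ : HCK K D →ₐc[K] Sh K D, ∀ x, letterProj K D (Φ x) = extendByZero φ x := by
  -- The only forest of degree `0` is the empty one, which is not a tree, so the extension by zero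
  -- may be lifted.
  obtain ⟨Φ, hΦ⟩ := Sh.exists_coalgHom (b := basis K) (deg := Forest.degree)
    (g := extendByZero φ) (comul_mem K) (fun F hF => by
      rw [Forest.degree_eq_zero_iff.1 hF, extendByZero_of_not_isTree φ Forest.not_isTree_one])
  have hcounit : ∀ y, counit (R := K) (Φ y) = counit (R := K) y := fun y =>
    CoalgHomClass.counit_comp_apply Φ y
  -- The product of a bialgebra is a coalgebra morphism, so multiplicativity is an equality of
  -- coalgebra morphisms on the tensor square and can be checked on one-letter components.
  have hmul : (Bialgebra.mulCoalgHom K (Sh K D)).comp (Coalgebra.TensorProduct.map Φ Φ) =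
      Φ.comp (Bialgebra.mulCoalgHom K (HCK K D)) := by
    refine Sh.coalgHom_ext fun z => ?_
    induction z with
    | zero => simp only [map_zero]
    | add x y hx hy => simp only [map_add, hx, hy]
    | tmul x y =>
      change letterProj K D (Φ x * Φ y) = letterProj K D (Φ (x * y))
      rw [Sh.letterProj_mul, hΦ, hΦ, hΦ, hcounit, hcounit, extendByZero_mul]
  -- The same argument for the units, as coalgebra morphisms from `K`: both one-letter components
  -- are zero.
  have hone : Φ.comp (Bialgebra.unitBialgHom K (HCK K D) : K →ₗc[K] HCK K D) =
      (Bialgebra.unitBialgHom K (Sh K D) : K →ₗc[K] Sh K D) := by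
    refine Sh.coalgHom_ext fun c => ?_
    change letterProj K D (Φ (algebraMap K _ c)) = letterProj K D (algebraMap K _ c)
    rw [Algebra.algebraMap_eq_smul_one, Algebra.algebraMap_eq_smul_one, map_smul, map_smul,
      map_smul, Sh.letterProj_one, hΦ, ← basis_one,
      extendByZero_of_not_isTree φ Forest.not_isTree_one]
  refine ⟨{ Φ with
    map_one' := ?_
    map_mul' := fun x y => (DFunLike.congr_fun hmul (x ⊗ₜ[K] y)).symm }, hΦ⟩
  have := DFunLike.congr_fun hone (1 : K)
  change Φ (algebraMap K _ 1) = algebraMap K _ 1 at this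
  rwa [map_one (algebraMap K (HCK K D)), map_one (algebraMap K (Sh K D))] at this

end HCK

end CutShuffle

theorem mainTheorem8 (K : Type*) [Field K] [CharZero K] (D : Type*) [Nonempty D]
    (φ : (CutShuffle.Tree D →₀ K) →ₗ[K] (D →₀ K)) :
    ∃! Φ : CutShuffle.HCK K D →ₐc[K] CutShuffle.Sh K D,
      CutShuffle.letterProj K D ∘ₗ (Φ : CutShuffle.HCK K D →ₗ[K] CutShuffle.Sh K D) ∘ₗ
        CutShuffle.treeIncl K D = φ := by
  obtain ⟨Φ, hΦ⟩ := CutShuffle.HCK.exists_bialgHom φ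
  refine ⟨Φ, ?_, fun Ψ hΨ => ?_⟩
  · refine Eq.trans (LinearMap.ext fun x => ?_) (CutShuffle.HCK.extendByZero_comp_treeIncl φ)
    exact hΦ _
  -- Both morphisms have the extension of `φ` by zero as one-letter component, and cofreeness leaves
  -- no other freedom.
  · refine BialgHom.coe_coalgHom_injective (CutShuffle.Sh.coalgHom_ext fun x => ?_)
    exact (CutShuffle.HCK.letterProj_comp_eq_extendByZero Ψ hΨ x).trans (hΦ x).symm
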